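/- Let $\Sigma=\{0,1\}$ and let $\Sigma^*$ be the set of finite non-empty strings over $\Sigma$. A promise problem is a function $\phi$ that assigns to each $x\in\Sigma^*$ a non-empty set $\phi(x)\subseteq\Sigma$ of valid answers; a function $\phi:\Sigma^*\to\Sigma$ is regarded as the promise problem $x\mapsto\{\phi(x)\}$. Write $\phi_1\propto\phi_2$ if there is a function $\mu:\Sigma^*\to\Sigma^*$, computable by a Turing machine in time polynomial in the length of its input, with $\phi_1(x)\supseteq\phi_2(\mu(x))$ for all $x\in\Sigma^*$, and let $[\phi]=\{\psi\mid\psi\propto\phi\}$ be the strong closure of $\phi$. Let $n\ge 1$. The following problems take as input (the encoding of) a function $f:\Sigma^{m_1}\times\cdots\times\Sigma^{m_n}\to\Sigma$ with all $m_i\ge1$, given by $m_1,\dots,m_n$ in binary and by a Boolean expression in $\land,\lor,\lnot$; for $x\in\Sigma^{m_1}$ let $f_x$ be the function of the remaining $n-1$ blocks obtained by fixing the first block to be $x$. (The encoding is chosen so that every string encodes some $f$.) - $\mathrm{SAT}_n(f)=1$ if and only if $\overline{\mathrm{SAT}}_{n-1}(f_x)=1$ for some $x\in\Sigma^{m_1}$;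 - $\overline{\mathrm{SAT}}_n(f)=1$ if and only if $\mathrm{SAT}_{n-1}(f_x)=1$ for all $x\in\Sigma^{m_1}$; - $\mathrm{VAL}_n(f)=\{x_1\mid x\in\Sigma^{m_1},\ \overline{\mathrm{SAT}}_{n-1}(f_x)=1\}$, where $x_1$ is the first bit of $x$, if $\mathrm{SAT}_n(f)=1$, and $\mathrm{VAL}_n(f)=\Sigma$ otherwise. Here, for a function $f$ of no blocks, that is, a constant $f\in\Sigma$, $\mathrm{SAT}_0(f)=\overline{\mathrm{SAT}}_0(f)=f$. Put $\widehat\Sigma_n=[\mathrm{SAT}_n]$ (promise-$\Sigma_n$), $\widehat\Pi_n=[\overline{\mathrm{SAT}}_n]$ (promise-$\Pi_n$) and $\widehat{\mathrm V}_n=[\mathrm{VAL}_n]$. **Theorem.** For every $n\ge1$, $$\widehat{\mathrm V}_n=\widehat\Sigma_n\cap\widehat\Pi_n .$$ In particular $\mathrm{VAL}_n$ is complete for $\widehat\Sigma_n\cap\widehat\Pi_n$: it belongs to this class, and $\phi\propto\mathrm{VAL}_n$ for every $\phi$ in it. For $n=1$ this says that $\mathrm{VAL}=\mathrm{VAL}_1$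 is complete for promise-$(\mathrm{NP}\cap\mathrm{coNP})=\widehat\Sigma_1\cap\widehat\Pi_1$. -/

import Mathlib

namespace PromiseHierarchy

/-! ### Strings, problems and promise problems -/

/-- Finite non-empty strings over the alphabet of the two letters 0 = `false` and 1 = `true`. -/
abbrev Word : Type := {w : List Bool // w ≠ []}

/-- The non-empty subsets of the alphabet. -/
abbrev Answers : Type := {S : Set Bool // S.Nonempty}

/-- A non-promise problem. -/
abbrev Problem : Type := Word → Bool

/-- A promise problem assigns to each string the non-empty set of its valid answers. -/
abbrev PromiseProblem : Type := Word → Answers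

/-- A non-promise problem, treated as a promise problem. -/
def Problem.toPromise (φ : Problem) : PromiseProblem :=
  fun w => ⟨{φ w}, Set.singleton_nonempty _⟩

open Classical in
/-- The answer set `S` when the promise `P` holds; both answers are valid when it fails. -/
noncomputable def promise (S : Set Bool) (P : Prop) (h : P → S.Nonempty) : Answers :=
  if hP : P then ⟨S, h hP⟩ else ⟨Set.univ, Set.univ_nonempty⟩

/-! ### Strong (many-one) reductions -/

/-- `μ` is computed by a Turing machine whose running time is bounded by a polynomial in the length
of the input. -/
def PolyTime (μ : Word → Word) : Prop :=
  Nonempty (Turing.TM2ComputableInPolyTime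
    (Subtype.val : Word → List Bool) (Subtype.val : Word → List Bool) μ)

/-- Strong reduction `φ₁ ∝ φ₂`: a polynomial time `μ` with `φ₁ x ⊇ φ₂ (μ x)` for every string. -/
def StrongRed (φ₁ φ₂ : PromiseProblem) : Prop :=
  ∃ μ : Word → Word, PolyTime μ ∧ ∀ w : Word, (φ₂ (μ w) : Set Bool) ⊆ (φ₁ w : Set Bool)

/-- The strong closure `[φ]` of a promise problem. -/
def strongClosure (φ : PromiseProblem) : Set PromiseProblem := {ψ | StrongRed ψ φ}

/-- `φ` is complete for the class `C` under strong reductions. -/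
def IsCompleteFor (φ : PromiseProblem) (C : Set PromiseProblem) : Prop :=
  φ ∈ C ∧ ∀ ψ ∈ C, StrongRed ψ φ

/-! ### Boolean functions of `n` blocks of variables -/

/-- A function `f : Σ^{m₁} × ⋯ × Σ^{mₙ} → Σ` with all `mᵢ ≥ 1`.  The `i`-th block has length
`len i`, where `i` is counted from `0`. -/
structure BlockFun (n : ℕ) where
  len : Fin n → ℕ
  len_pos : ∀ i, 0 < len i
  toFun : ((i : Fin n) → (Fin (len i) → Bool)) → Bool

/-- The function `f_x` obtained from `f` by fixing the first block to be `x`. -/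
def BlockFun.fix {n : ℕ} (f : BlockFun (n + 1)) (x : Fin (f.len 0) → Bool) : BlockFun n where
  len := fun i => f.len i.succ
  len_pos := fun i => f.len_pos i.succ
  toFun := fun y => f.toFun (Fin.cons (α := fun i => Fin (f.len i) → Bool) x y)

mutual

/-- `∃ x, ∀ y⁽¹⁾, ∃ y⁽²⁾, …, f (x, y⁽¹⁾, y⁽²⁾, …) = 1`. -/
def IsSat : (n : ℕ) → BlockFun n → Prop
  | 0, f => f.toFun (fun i => i.elim0) = true
  | n + 1, f => ∃ x : Fin (f.len 0) → Bool, IsTaut n (f.fix x)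

/-- `∀ x, ∃ y⁽¹⁾, ∀ y⁽²⁾, …, f (x, y⁽¹⁾, y⁽²⁾, …) = 1`. -/
def IsTaut : (n : ℕ) → BlockFun n → Prop
  | 0, f => f.toFun (fun i => i.elim0) = true
  | n + 1, f => ∀ x : Fin (f.len 0) → Bool, IsSat n (f.fix x)

end

/-- The set of the first bits `π₁ x` of the witnesses `x` of `f`. -/
def firstBits {n : ℕ} (f : BlockFun (n + 1)) : Set Bool :=
  {b | ∃ x : Fin (f.len 0) → Bool, IsTaut n (f.fix x) ∧ x ⟨0, f.len_pos 0⟩ = b}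

theorem firstBits_nonempty {n : ℕ} (f : BlockFun (n + 1)) (h : IsSat (n + 1) f) :
    (firstBits f).Nonempty := by
  rw [IsSat] at h
  obtain ⟨x, hx⟩ := h
  exact ⟨_, x, hx, rfl⟩

/-! ### Boolean expressions and their encoding by strings -/

/-- Boolean expressions; `var i j` is the `j`-th variable of the `i`-th block, both counted
from `0`. -/
inductive Expr : Type
  | var (i j : ℕ) : Expr
  | not (e : Expr) : Expr
  | and (e₁ e₂ : Expr) : Expr
  | or (e₁ e₂ : Expr) : Expr

/-- The value of an expression under an assignment. -/
def Expr.eval (v : ℕ → ℕ → Bool) : Expr → Bool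
  | .var i j => v i j
  | .not e => !(e.eval v)
  | .and e₁ e₂ => e₁.eval v && e₂.eval v
  | .or e₁ e₂ => e₁.eval v || e₂.eval v

/-- The least number `m` such that all variables of the `i`-th block that occur in the expression
are among the first `m` variables of that block. -/
def Expr.bound (i : ℕ) : Expr → ℕ
  | .var i' j => if i' = i then j + 1 else 0
  | .not e => e.bound i
  | .and e₁ e₂ => max (e₁.bound i) (e₂.bound i)
  | .or e₁ e₂ => max (e₁.bound i) (e₂.bound i)

/-- The function of blocks of lengths `m i` given by an expression.  (Variables outside these
blocks are read as `0`.) -/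
def BlockFun.ofExpr {n : ℕ} (m : Fin n → ℕ) (hm : ∀ i, 0 < m i) (e : Expr) : BlockFun n where
  len := m
  len_pos := hm
  toFun := fun x => e.eval fun i j =>
    if h : ∃ hi : i < n, j < m ⟨i, hi⟩ then x ⟨i, h.1⟩ ⟨j, h.2⟩ else false

/-- Self-delimiting binary code of a number: the binary digits, least significant first, each
preceded by the bit `1`, and then the bit `0`. -/
def codeNat (m : ℕ) : List Bool := m.bits.flatMap (fun b => [true, b]) ++ [false]

/-- Code of an expression in prefix notation. -/
def codeExpr : Expr → List Bool
  | .var i j => false :: false :: (codeNat i ++ codeNat j)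
  | .not e => false :: true :: codeExpr e
  | .and e₁ e₂ => true :: false :: (codeExpr e₁ ++ codeExpr e₂)
  | .or e₁ e₂ => true :: true :: (codeExpr e₁ ++ codeExpr e₂)

/-- An instance is encoded by its expression, followed by the block lengths in binary. -/
def encode {n : ℕ} (m : Fin n → ℕ) (e : Expr) : List Bool :=
  codeExpr e ++ (List.ofFn m).flatMap codeNat

/-- Reads a number from the front of a string, and returns it with the rest of the string. -/
def readNat : List Bool → ℕ × List Bool
  | true :: b :: s => (b.toNat + 2 * (readNat s).1, (readNat s).2)
  | false :: s => (0, s)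
  | _ => (0, [])

/-- Reads an expression from the front of a string, and returns it with the rest of the string.
Missing subexpressions at the end of the string are read as the first variable of the first block.
The first argument is fuel; the length of the string suffices. -/
def readExpr : ℕ → List Bool → Expr × List Bool
  | _ + 1, false :: false :: s =>
      (.var (readNat s).1 (readNat (readNat s).2).1, (readNat (readNat s).2).2)
  | k + 1, false :: true :: s => (.not (readExpr k s).1, (readExpr k s).2)
  | k + 1, true :: false :: s =>
      (.and (readExpr k s).1 (readExpr k (readExpr k s).2).1, (readExpr k (readExpr k s).2).2)
  | k + 1, true :: true :: s =>
      (.or (readExpr k s).1 (readExpr k (readExpr k s).2).1, (readExpr k (readExpr k s).2).2)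
  | _, _ => (.var 0 0, [])

/-- The `i`-th number (counted from `0`) in a string that lists numbers. -/
def readNth : ℕ → List Bool → ℕ
  | 0, s => (readNat s).1
  | i + 1, s => readNth i (readNat s).2

/-- The function encoded by a string: an expression is read, and then the block lengths.  So that
every string encodes a function, a listed block length that is `0`, or smaller than the index of a
variable that occurs, is replaced by the least admissible one. -/
def decode (n : ℕ) (s : List Bool) : BlockFun n :=
  BlockFun.ofExpr
    (fun i => max 1 (max ((readExpr s.length s).1.bound i) (readNth i (readExpr s.length s).2)))
    (fun _ => lt_of_lt_of_le Nat.zero_lt_one (le_max_left _ _))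
    (readExpr s.length s).1

theorem readNat_codeNat (m : ℕ) (s : List Bool) : readNat (codeNat m ++ s) = (m, s) := by
  induction m using Nat.binaryRec' generalizing s with
  | zero => simp [codeNat, readNat]
  | bit b k h ih =>
    have := ih s
    simp only [codeNat] at this ⊢
    rw [Nat.bits_append_bit _ _ h]
    simp only [List.flatMap_cons, List.cons_append, List.nil_append, List.append_assoc] at this ⊢
    rw [readNat, this]
    simp [Nat.bit_val, add_comm]

theorem readExpr_codeExpr (e : Expr) (s : List Bool) (k : ℕ) (hk : (codeExpr e).length ≤ k) :
    readExpr k (codeExpr e ++ s) = (e, s) := by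
  induction e generalizing s k with
  | var i j =>
    obtain _ | k := k
    · simp [codeExpr] at hk
    · simp [codeExpr, readExpr, readNat_codeNat]
  | not e ih =>
    obtain _ | k := k
    · simp [codeExpr] at hk
    · simp only [codeExpr, List.length_cons] at hk
      simp [codeExpr, readExpr, ih s k (by omega)]
  | and e₁ e₂ ih₁ ih₂ =>
    obtain _ | k := k
    · simp [codeExpr] at hk
    · simp only [codeExpr, List.length_cons, List.length_append] at hk
      simp [codeExpr, readExpr, ih₁ _ k (by omega), ih₂ _ k (by omega)]
  | or e₁ e₂ ih₁ ih₂ =>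
    obtain _ | k := k
    · simp [codeExpr] at hk
    · simp only [codeExpr, List.length_cons, List.length_append] at hk
      simp [codeExpr, readExpr, ih₁ _ k (by omega), ih₂ _ k (by omega)]

theorem readNth_flatMap (l : List ℕ) (i : ℕ) (hi : i < l.length) :
    readNth i (l.flatMap codeNat) = l[i] := by
  induction l generalizing i with
  | nil => simp at hi
  | cons a l ih =>
    cases i with
    | zero => simp [readNth, readNat_codeNat]
    | succ i => simpa [readNth, readNat_codeNat] using ih i (by simpa using hi)

/-- `decode` inverts `encode`, for all block lengths and all expressions in these variables. -/
theorem decode_encode {n : ℕ} (m : Fin n → ℕ) (hm : ∀ i, 0 < m i) (e : Expr)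
    (he : ∀ i : Fin n, e.bound i ≤ m i) : decode n (encode m e) = BlockFun.ofExpr m hm e := by
  have h : readExpr (encode m e).length (encode m e) = (e, (List.ofFn m).flatMap codeNat) :=
    readExpr_codeExpr _ _ _ (by simp [encode])
  have h2 : (fun i : Fin n => max 1 (max (e.bound i)
      (readNth i ((List.ofFn m).flatMap codeNat)))) = m := by
    funext i
    rw [readNth_flatMap _ _ (by simp)]
    simp only [List.getElem_ofFn, Fin.eta]
    rw [max_eq_right (he i), max_eq_right (hm i)]
  simp only [decode, h]
  congr 1

/-! ### The complete problems and the classes -/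

open Classical in
/-- `SAT_n`. -/
noncomputable def SAT (n : ℕ) : Problem := fun w => decide (IsSat n (decode n w.1))

open Classical in
/-- The dual problem of `SAT_n`, with the quantifiers `∀ ∃ ∀ ⋯`. -/
noncomputable def coSAT (n : ℕ) : Problem := fun w => decide (IsTaut n (decode n w.1))

/-- `VAL_n`: find the first bit of some witness.  It is meant for `n ≥ 1`; the value at `n = 0` is
a placeholder. -/
noncomputable def VAL : ℕ → PromiseProblem
  | 0 => fun _ => ⟨Set.univ, Set.univ_nonempty⟩
  | n + 1 => fun w => promise (firstBits (decode (n + 1) w.1)) (IsSat (n + 1) (decode (n + 1) w.1))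
      (firstBits_nonempty _)

/-- promise-`Σ_n`, the strong closure of `SAT_n`. -/
noncomputable def SigmaHat (n : ℕ) : Set PromiseProblem := strongClosure (SAT n).toPromise

/-- promise-`Π_n`, the strong closure of the dual of `SAT_n`. -/
noncomputable def PiHat (n : ℕ) : Set PromiseProblem := strongClosure (coSAT n).toPromise

/-- The strong closure of `VAL_n`. -/
noncomputable def VHat (n : ℕ) : Set PromiseProblem := strongClosure (VAL n)

end PromiseHierarchy

-- Write `x₁` for the first bit of the first block. A witness of `f` beginning with 1 exists iff `x₁
-- ∧ f` is satisfiable, and none begins with 0 iff `x₁ ∨ ¬f` is a tautology in the dual sense.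
-- Either truth value is a valid answer of `VAL`: if one bit begins no witness, the other bit does,
-- or else there is no witness and both answers are valid. This reduces `VAL` to `SAT` and to
-- `coSAT` (`VAL_strongRed_SAT`, `VAL_strongRed_coSAT`).
--
-- Conversely, let `φ` reduce to `SAT` by giving `f` and to `coSAT` by giving `g`. Let `x'` be a
-- part of the variables that omits `x₁`, and put `h = (x₁ ∧ f(x')) ∨ (¬x₁ ∧ ¬g(x'))`. Some witness
-- of `h` begins with 1 iff `SAT f = 1`, and some begins with 0 iff `coSAT g = 0`. So a valid answer
-- of `VAL` on `h` always equals `SAT f` or `coSAT g`, and both of these are valid for `φ`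
-- (`strongRed_VAL`).
--
-- Most of the work lies in exhibiting these maps on strings as polynomial time machines. In prefix
-- notation a connective is applied by prepending a fixed word, so constants, concatenation and
-- composition suffice, together with one parser (`exists_isolate`). The parser cuts a string down
-- to its expression, so that another can follow, and moves variable `j` to `2 * j + 1`, which frees
-- `x₁`. The block lengths that a string lists are irrelevant: an expression sees only the variables
-- that occur in it, so the quantifiers may range over infinite rows (`Extends.iff_and`,
-- `extends_decode`).

namespace PromiseHierarchy

open Turing Turing.TM2

/-! ### Multi-stack programs -/

/-- `Steps m t c c'`: the machine `m` gets from `c` to `c'` in exactly `t` steps. -/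
inductive Steps {K : Type} [DecidableEq K] {Γ : K → Type} {Λ σ : Type} (m : Λ → Stmt Γ Λ σ) :
    ℕ → Cfg Γ Λ σ → Cfg Γ Λ σ → Prop
  | refl (c) : Steps m 0 c c
  | head {t c c' c''} : step m c = some c' → Steps m t c' c'' → Steps m (t + 1) c c''

namespace Steps

variable {K : Type} [DecidableEq K] {Γ : K → Type} {Λ σ : Type} {m : Λ → Stmt Γ Λ σ}

theorem trans {s t : ℕ} {a b c : Cfg Γ Λ σ} (h₁ : Steps m s a b) (h₂ : Steps m t b c) :
    Steps m (s + t) a c := by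
  induction h₁ with
  | refl => simpa using h₂
  | head h _ ih =>
    rw [Nat.add_right_comm]
    exact .head h (ih h₂)

theorem iff_iterate {t : ℕ} {a b : Cfg Γ Λ σ} :
    Steps m t a b ↔ (flip bind (step m))^[t] (some a) = some b := by
  induction t generalizing a with
  | zero =>
    constructor
    · rintro ⟨⟩; rfl
    · intro h; cases h; exact .refl _
  | succ t ih =>
    rw [Function.iterate_succ_apply]
    have hn : (flip bind (step m))^[t] none = none := by
      clear ih
      induction t with
      | zero => rfl
      | succ t ih => rw [Function.iterate_succ_apply]; exact ih
    change _ ↔ (flip bind (step m))^[t] (step m a) = some b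
    constructor
    · rintro (_ | ⟨h, h'⟩)
      rw [h]; exact ih.1 h'
    · intro h
      cases h' : step m a with
      | none => rw [h', hn] at h; cases h
      | some c => rw [h'] at h; exact .head h' (ih.2 h)

end Steps

/-- A program on the stacks `K`. -/
structure Prog (K : Type) (Γ : K → Type) where
  Λ : Type
  [finΛ : Fintype Λ]
  main : Λ
  σ : Type
  [finσ : Fintype σ]
  init : σ
  m : Λ → Stmt Γ Λ σ

/-- The program turns the stacks `S` into `S'` in at most `t` steps, and resets its state. -/
def Prog.Run {K : Type} [DecidableEq K] {Γ : K → Type} (P : Prog K Γ)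
    (S S' : ∀ k, List (Γ k)) (t : ℕ) : Prop :=
  ∃ s ≤ t, Steps P.m s ⟨some P.main, P.init, S⟩ ⟨none, P.init, S'⟩

-- Simulation of a machine inside a larger one

section Translation

variable {K K' : Type} {Γ : K' → Type} {Λ Λ' σ σ' : Type}

/-- A statement read as one of a larger machine, which has more stacks, labels and states, and
continues at `next` where the smaller one halts. -/
def trStmt (ι : K → K') (lam : Λ → Λ') (next : Option Λ') (get : σ' → σ) (set : σ' → σ → σ') :
    Stmt (fun k => Γ (ι k)) Λ σ → Stmt Γ Λ' σ'
  | .push k f q => .push (ι k) (fun s => f (get s)) (trStmt ι lam next get set q)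
  | .peek k f q => .peek (ι k) (fun s o => set s (f (get s) o)) (trStmt ι lam next get set q)
  | .pop k f q => .pop (ι k) (fun s o => set s (f (get s) o)) (trStmt ι lam next get set q)
  | .load f q => .load (fun s => set s (f (get s))) (trStmt ι lam next get set q)
  | .branch f q₁ q₂ => .branch (fun s => f (get s)) (trStmt ι lam next get set q₁)
      (trStmt ι lam next get set q₂)
  | .goto l => .goto (fun s => lam (l (get s)))
  | .halt => match next with
    | none => .halt
    | some l => .goto (fun _ => l)

/-- The configuration `d` of the larger machine corresponds to `c`; `v₀` and `S₀` describe the part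
that the smaller machine does not see. -/
structure Sim (ι : K → K') (lam : Λ → Λ') (next : Option Λ') (set : σ' → σ → σ') (v₀ : σ')
    (S₀ : ∀ k, List (Γ k)) (c : Cfg (fun k => Γ (ι k)) Λ σ) (d : Cfg Γ Λ' σ') : Prop where
  label : d.l = c.l.elim next (fun l => some (lam l))
  state : d.var = set v₀ c.var
  stack : ∀ k, d.stk (ι k) = c.stk k
  frame : ∀ k', (∀ k, ι k ≠ k') → d.stk k' = S₀ k'

variable [DecidableEq K] [DecidableEq K'] {ι : K → K'} (hι : Function.Injective ι) {lam : Λ → Λ'}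
  {next : Option Λ'} {get : σ' → σ} {set : σ' → σ → σ'} (hgs : ∀ s a, get (set s a) = a)
  (hss : ∀ s a b, set (set s a) b = set s b) {v₀ : σ'}

include hι hgs hss in
theorem Sim.stepAux (q : Stmt (fun k => Γ (ι k)) Λ σ) (v : σ)
    (S : ∀ k, List (Γ (ι k))) (S₀ S' : ∀ k, List (Γ k)) (hS : ∀ k, S' (ι k) = S k)
    (hf : ∀ k', (∀ k, ι k ≠ k') → S' k' = S₀ k') :
    Sim ι lam next set v₀ S₀ (TM2.stepAux q v S)
      (TM2.stepAux (trStmt ι lam next get set q) (set v₀ v) S') := by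
  have hu : ∀ (S : ∀ k, List (Γ (ι k))) (S' : ∀ k, List (Γ k)), (∀ k, S' (ι k) = S k) →
      ∀ k x k', Function.update S' (ι k) x (ι k') = Function.update S k x k' := by
    intro S S' h k x k'
    by_cases e : k' = k
    · subst e; simp
    · rw [Function.update_of_ne e, Function.update_of_ne (fun h => e (hι h)), h]
  induction q generalizing v S S' with
  | push k f q ih =>
    simp only [trStmt, TM2.stepAux, hgs]
    refine ih _ _ _ (fun k' => ?_) (fun k' h => ?_)
    · rw [hS, hu _ _ hS]
    · rw [Function.update_of_ne (h k).symm, hf _ h]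
  | peek k f q ih =>
    simp only [trStmt, TM2.stepAux, hgs, hss, hS]
    exact ih _ _ _ hS hf
  | pop k f q ih =>
    simp only [trStmt, TM2.stepAux, hgs, hss, hS]
    refine ih _ _ _ (fun k' => ?_) (fun k' h => ?_)
    · rw [hu _ _ hS]
    · rw [Function.update_of_ne (h k).symm, hf _ h]
  | load f q ih =>
    simp only [trStmt, TM2.stepAux, hgs, hss]
    exact ih _ _ _ hS hf
  | branch f q₁ q₂ ih₁ ih₂ =>
    simp only [trStmt, TM2.stepAux, hgs]
    cases f v
    · exact ih₂ _ _ _ hS hf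
    · exact ih₁ _ _ _ hS hf
  | goto l => exact ⟨by simp [trStmt, TM2.stepAux, hgs], rfl, hS, hf⟩
  | halt => cases next <;> exact ⟨rfl, rfl, hS, hf⟩

-- The simulation is step for step. When the smaller machine halts, the larger one already stands at
-- `next`, so handing over costs no extra step.
include hι hgs hss in
theorem Sim.steps {m : Λ → Stmt (fun k => Γ (ι k)) Λ σ} {M : Λ' → Stmt Γ Λ' σ'}
    (hM : ∀ l, M (lam l) = trStmt ι lam next get set (m l)) {t : ℕ} {S₀ : ∀ k, List (Γ k)}
    {c c' : Cfg (fun k => Γ (ι k)) Λ σ} (h : Steps m t c c') {d : Cfg Γ Λ' σ'}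
    (hd : Sim ι lam next set v₀ S₀ c d) :
    ∃ d', Steps M t d d' ∧ Sim ι lam next set v₀ S₀ c' d' := by
  induction h generalizing d with
  | refl => exact ⟨d, .refl _, hd⟩
  | @head t c c₁ c₂ hs _ ih =>
    obtain ⟨_ | l, v, S⟩ := c
    · simp at hs
    · simp only [step, Option.some.injEq] at hs
      subst hs
      obtain ⟨l', v', S'⟩ := d
      obtain ⟨h₁, h₂, h₃, h₄⟩ := hd
      simp only [Option.elim] at h₁ h₂ h₃ h₄
      subst h₁ h₂
      obtain ⟨d', hd', hd''⟩ := ih (Sim.stepAux hι hgs hss (m l) v S S₀ S' h₃ h₄)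
      refine ⟨d', .head ?_ hd', hd''⟩
      rw [step, hM]

end Translation

-- Combinators and elementary programs

namespace Prog

variable {K : Type} [DecidableEq K] {Γ : K → Type}

theorem Run.mono {P : Prog K Γ} {S S' : ∀ k, List (Γ k)} {s t : ℕ} (h : P.Run S S' s)
    (hst : s ≤ t) : P.Run S S' t := by
  obtain ⟨u, hu, h⟩ := h
  exact ⟨u, hu.trans hst, h⟩

/-- Run `P`, then `Q`. -/
def seq (P Q : Prog K Γ) : Prog K Γ where
  Λ := P.Λ ⊕ Q.Λ
  finΛ := letI := P.finΛ; letI := Q.finΛ; inferInstance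
  main := .inl P.main
  σ := P.σ × Q.σ
  finσ := letI := P.finσ; letI := Q.finσ; inferInstance
  init := (P.init, Q.init)
  m := Sum.elim
    (fun l => trStmt (Γ := Γ) id .inl (some (.inr Q.main)) Prod.fst (fun s a => (a, s.2)) (P.m l))
    (fun l => trStmt (Γ := Γ) id .inr none Prod.snd (fun s a => (s.1, a)) (Q.m l))

theorem Run.seq {P Q : Prog K Γ} {S S' S'' : ∀ k, List (Γ k)} {s t : ℕ} (h₁ : P.Run S S' s)
    (h₂ : Q.Run S' S'' t) : (P.seq Q).Run S S'' (s + t) := by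
  obtain ⟨s', hs, h₁⟩ := h₁
  obtain ⟨t', ht, h₂⟩ := h₂
  obtain ⟨⟨l, v, T⟩, hd, e₁, e₂, e₃, -⟩ := Sim.steps (Γ := Γ) (M := (P.seq Q).m) (ι := id)
    (lam := Sum.inl) (next := some (.inr Q.main)) (get := Prod.fst) (set := fun s a => (a, s.2))
    Function.injective_id (fun _ _ => rfl) (fun _ _ _ => rfl) (v₀ := (P.init, Q.init)) (S₀ := S)
    (fun _ => rfl) h₁ (d := ⟨some (.inl P.main), (P.init, Q.init), S⟩)
    ⟨rfl, rfl, fun _ => rfl, fun _ _ => rfl⟩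
  obtain ⟨⟨l', v', T'⟩, hd', e₁', e₂', e₃', -⟩ := Sim.steps (Γ := Γ) (M := (P.seq Q).m) (ι := id)
    (lam := Sum.inr) (next := none) (get := Prod.snd) (set := fun s a => (s.1, a))
    Function.injective_id (fun _ _ => rfl) (fun _ _ _ => rfl) (v₀ := (P.init, Q.init)) (S₀ := S)
    (fun _ => rfl) h₂ (d := ⟨some (.inr Q.main), (P.init, Q.init), S'⟩)
    ⟨rfl, rfl, fun _ => rfl, fun k h => absurd rfl (h k)⟩
  obtain rfl : T = S' := funext e₃
  obtain rfl : T' = S'' := funext e₃'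
  simp only [Option.elim] at e₁ e₂ e₁' e₂'
  subst e₁ e₂ e₁' e₂'
  exact ⟨s' + t', by omega, hd.trans hd'⟩

/-- A program on some of the stacks. -/
def lift {L : Type} (ι : L → K) (P : Prog L (fun k => Γ (ι k))) : Prog K Γ where
  Λ := P.Λ
  finΛ := P.finΛ
  main := P.main
  σ := P.σ
  finσ := P.finσ
  init := P.init
  m l := trStmt ι id none id (fun _ a => a) (P.m l)

theorem Run.lift {L : Type} [DecidableEq L] {ι : L → K} (hι : Function.Injective ι)
    {P : Prog L (fun k => Γ (ι k))} {t : ℕ} {S S' : ∀ k, List (Γ k)}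
    (h : P.Run (fun k => S (ι k)) (fun k => S' (ι k)) t)
    (hS : ∀ k', (∀ k, ι k ≠ k') → S' k' = S k') : (P.lift ι).Run S S' t := by
  obtain ⟨s, hs, h⟩ := h
  obtain ⟨⟨l, v, T⟩, hd, e₁, e₂, e₃, e₄⟩ := Sim.steps (Γ := Γ) (M := (P.lift ι).m) (ι := ι)
    (lam := id) (next := none) (get := id) (set := fun _ a => a)
    hι (fun _ _ => rfl) (fun _ _ _ => rfl) (v₀ := P.init) (S₀ := S)
    (fun _ => rfl) h (d := ⟨some P.main, P.init, S⟩)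
    ⟨rfl, rfl, fun _ => rfl, fun _ _ => rfl⟩
  obtain rfl : T = S' := by
    funext k
    by_cases hk : ∃ k', ι k' = k
    · obtain ⟨k', rfl⟩ := hk
      exact e₃ k'
    · push Not at hk
      exact (e₄ k hk).trans (hS k hk).symm
  simp only [Option.elim] at e₁ e₂
  subst e₁ e₂
  exact ⟨s, hs, hd⟩

/-- Empties the stack `a`, and pushes every letter on the stacks `b` and `c`. -/
def dup (a b c : K) (e : Γ a → Bool) (f : Bool → Γ b) (g : Bool → Γ c) : Prog K Γ where
  Λ := Unit
  main := ()
  σ := Option Bool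
  init := none
  m _ := .pop a (fun _ o => o.map e) <| .branch Option.isSome
    (.push b (fun o => f (o.getD false)) <| .push c (fun o => g (o.getD false)) <|
      .load (fun _ => none) <| .goto (fun _ => ()))
    .halt

/-- `S'` is described by its values, so that it can be any given family; it stays fixed while the
induction changes `S`. The final pass, which finds the stack `a` empty, accounts for the `+ 1`. -/
theorem run_dup {a b c : K} (hab : a ≠ b) (hac : a ≠ c) (hbc : b ≠ c) (e : Γ a → Bool)
    (f : Bool → Γ b) (g : Bool → Γ c) {S S' : ∀ k, List (Γ k)} (ha : S' a = [])
    (hb : S' b = ((S a).map (fun x => f (e x))).reverse ++ S b)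
    (hc : S' c = ((S a).map (fun x => g (e x))).reverse ++ S c)
    (h : ∀ k, k ≠ a → k ≠ b → k ≠ c → S' k = S k) :
    (dup a b c e f g).Run S S' ((S a).length + 1) := by
  refine ⟨(S a).length + 1, le_rfl, ?_⟩
  generalize hl : S a = l at *
  induction l generalizing S with
  | nil =>
    refine .head (c' := ⟨none, none, S'⟩) ?_ (.refl _)
    have : S' = S := by
      funext k
      by_cases h1 : k = a
      · rw [h1, ha, hl]
      by_cases h2 : k = b
      · rw [h2, hb]; simp
      by_cases h3 : k = c
      · rw [h3, hc]; simp
      exact h k h1 h2 h3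
    subst this
    simp [dup, hl]
  | cons x l ih =>
    refine .head (c' := ⟨some (), none, Function.update (Function.update (Function.update S a l) b
      (f (e x) :: S b)) c (g (e x) :: S c)⟩) ?_ (ih ?_ ?_ ?_ ?_)
    · simp [dup, hl, hab.symm, hac.symm, hbc.symm]
    · intro k h1 h2 h3
      simp [h1, h2, h3, h]
    · simp [hab, hac]
    · simp [hb, hbc]
    · simp [hc]

/-- Empties the stack `a`, and pushes every letter on the stack `b`. -/
def move (a b : K) (e : Γ a → Bool) (f : Bool → Γ b) : Prog K Γ where
  Λ := Unit
  main := ()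
  σ := Option Bool
  init := none
  m _ := .pop a (fun _ o => o.map e) <| .branch Option.isSome
    (.push b (fun o => f (o.getD false)) <| .load (fun _ => none) <| .goto (fun _ => ()))
    .halt

theorem run_move {a b : K} (hab : a ≠ b) (e : Γ a → Bool) (f : Bool → Γ b)
    {S S' : ∀ k, List (Γ k)} (ha : S' a = [])
    (hb : S' b = ((S a).map (fun x => f (e x))).reverse ++ S b)
    (h : ∀ k, k ≠ a → k ≠ b → S' k = S k) :
    (move a b e f).Run S S' ((S a).length + 1) := by
  refine ⟨(S a).length + 1, le_rfl, ?_⟩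
  generalize hl : S a = l at *
  induction l generalizing S with
  | nil =>
    refine .head (c' := ⟨none, none, S'⟩) ?_ (.refl _)
    have : S' = S := by
      funext k
      by_cases h1 : k = a
      · rw [h1, ha, hl]
      by_cases h2 : k = b
      · rw [h2, hb]; simp
      exact h k h1 h2
    subst this
    simp [move, hl]
  | cons x l ih =>
    refine .head (c' := ⟨some (), none, Function.update (Function.update S a l) b
      (f (e x) :: S b)⟩) ?_ (ih ?_ ?_ ?_)
    · simp [move, hl, hab.symm]
    · intro k h1 h2
      simp [h1, h2, h]
    · simp [hab]
    · simp [hb]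

/-- Empties the stack `a`. -/
def clear (a : K) : Prog K Γ where
  Λ := Unit
  main := ()
  σ := Bool
  init := false
  m _ := .pop a (fun _ o => o.isSome) <| .branch id
    (.load (fun _ => false) <| .goto (fun _ => ())) .halt

theorem run_clear {a : K} {S S' : ∀ k, List (Γ k)} (ha : S' a = [])
    (h : ∀ k, k ≠ a → S' k = S k) : (clear a).Run S S' ((S a).length + 1) := by
  refine ⟨(S a).length + 1, le_rfl, ?_⟩
  generalize hl : S a = l at *
  induction l generalizing S with
  | nil =>
    refine .head (c' := ⟨none, false, S'⟩) ?_ (.refl _)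
    have : S' = S := by
      funext k
      by_cases h1 : k = a
      · rw [h1, ha, hl]
      exact h k h1
    subst this
    simp [clear, hl]
  | cons x l ih =>
    refine .head (c' := ⟨some (), false, Function.update S a l⟩) ?_ (ih ?_ ?_)
    · simp [clear, hl]
    · intro k h1
      simp [h1, h]
    · simp

/-- Pushes a word on the stack `a`. -/
def write (a : K) (l : List (Γ a)) : Prog K Γ where
  Λ := Unit
  main := ()
  σ := Unit
  init := ()
  m _ := l.foldr (fun x q => .push a (fun _ => x) q) .halt

theorem run_write {a : K} (l : List (Γ a)) {S S' : ∀ k, List (Γ k)} (ha : S' a = l.reverse ++ S a)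
    (h : ∀ k, k ≠ a → S' k = S k) : (write a l).Run S S' 1 := by
  refine ⟨1, le_rfl, .head (c' := ⟨none, (), S'⟩) ?_ (.refl _)⟩
  simp only [write, step, Option.some.injEq]
  induction l generalizing S with
  | nil =>
    have : S = S' := by
      funext k
      by_cases h1 : k = a
      · rw [h1, ha]; simp
      exact (h k h1).symm
    simp [this]
  | cons x l ih =>
    simp only [List.foldr_cons, TM2.stepAux]
    refine ih ?_ ?_
    · simp [ha]
    · intro k h1
      simp [h1, h]

/-- The number of letters that a statement can push. -/
def pushes {Λ σ : Type} : Stmt Γ Λ σ → ℕ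
  | .push _ _ q => pushes q + 1
  | .peek _ _ q => pushes q
  | .pop _ _ q => pushes q
  | .load _ q => pushes q
  | .branch _ q₁ q₂ => max (pushes q₁) (pushes q₂)
  | .goto _ => 0
  | .halt => 0

theorem length_stepAux_le {Λ σ : Type} (q : Stmt Γ Λ σ) (v : σ) (S : ∀ k, List (Γ k)) (k : K) :
    ((TM2.stepAux q v S).stk k).length ≤ (S k).length + pushes q := by
  induction q generalizing v S with
  | push k' f q ih =>
    refine (ih _ _).trans ?_
    by_cases h : k = k'
    · subst h; simp [pushes]; omega
    · simp [pushes, h]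
  | peek k' f q ih => exact ih _ _
  | pop k' f q ih =>
    refine (ih _ _).trans ?_
    by_cases h : k = k'
    · subst h; simp [pushes]
    · simp [pushes, h]
  | load f q ih => exact ih _ _
  | branch f q₁ q₂ ih₁ ih₂ =>
    simp only [TM2.stepAux, pushes]
    cases f v
    · exact (ih₂ _ _).trans (by simp)
    · exact (ih₁ _ _).trans (by simp)
  | goto l => exact Nat.le_refl _
  | halt => exact Nat.le_refl _

/-- There are finitely many labels, and each statement pushes boundedly many letters. Output length
is thus polynomially bounded, as composition requires. -/
theorem exists_length_le (P : Prog K Γ) : ∃ C, ∀ S S' t, P.Run S S' t →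
    ∀ k, (S' k).length ≤ (S k).length + C * t := by
  have := P.finΛ
  obtain ⟨C, hC⟩ := (Set.finite_range fun l => pushes (P.m l)).bddAbove
  refine ⟨C, fun S S' t ⟨s, hs, h⟩ k => ?_⟩
  suffices ∀ s c c', Steps P.m s c c' → (c'.stk k).length ≤ (c.stk k).length + C * s from
    (this _ _ _ h).trans (by gcongr)
  clear hs h
  intro s c c' h
  induction h with
  | refl => simp
  | @head t c c₁ c₂ hs _ ih =>
    obtain ⟨_ | l, v, T⟩ := c
    · simp at hs
    · simp only [step, Option.some.injEq] at hs
      subst hs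
      have := length_stepAux_le (P.m l) v T k
      have h2 : pushes (P.m l) ≤ C := hC ⟨l, rfl⟩
      rw [mul_add]
      dsimp only at ih this ⊢
      omega

end Prog

/-! ### Closure properties of polynomial time -/

/-- All stacks are empty, except that `a` holds `l`. -/
def single {K : Type} [DecidableEq K] {Γ : K → Type} (a : K) (l : List (Γ a)) (k : K) :
    List (Γ k) :=
  Function.update (fun _ => []) a l k

section single

variable {K : Type} [DecidableEq K] {Γ : K → Type} {a : K} {l : List (Γ a)}

@[simp]
theorem single_self : single a l a = l := by simp [single]

@[simp]
theorem single_of_ne {k : K} (h : k ≠ a) : single a l k = [] := by simp [single, h]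

theorem eq_single {S : ∀ k, List (Γ k)} (ha : S a = l) (h : ∀ k, k ≠ a → S k = []) :
    S = single a l := by
  funext k
  by_cases hk : k = a
  · subst hk; rw [ha, single_self]
  · rw [h k hk, single_of_ne hk]

end single

theorem initList_stk (tm : FinTM2) (l : List (tm.Γ tm.k₀)) :
    (initList tm l).stk = single tm.k₀ l := by
  funext k
  by_cases h : k = tm.k₀
  · subst h; simp [initList]
  · simp [initList, h]

theorem haltList_stk (tm : FinTM2) (l : List (tm.Γ tm.k₁)) :
    (haltList tm l).stk = single tm.k₁ l := by
  funext k
  by_cases h : k = tm.k₁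
  · subst h; simp [haltList]
  · simp [haltList, h]

/-- The program `P` computes `μ` in time `p`, with input stack `a` and output stack `b`. -/
def Computes {K : Type} [DecidableEq K] {Γ : K → Type} (P : Prog K Γ) (a b : K) (e₀ : Bool ≃ Γ a)
    (e₁ : Bool ≃ Γ b) (p : Polynomial ℕ) (μ : Word → Word) : Prop :=
  ∀ w : Word, P.Run (single a (w.1.map e₀)) (single b ((μ w).1.map e₁)) (p.eval w.1.length)

theorem PolyTime.of_computes {K : Type} [DecidableEq K] [Fintype K] {Γ : K → Type} {P : Prog K Γ}
    {a b : K} {e₀ : Bool ≃ Γ a} {e₁ : Bool ≃ Γ b} {p : Polynomial ℕ} {μ : Word → Word}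
    (h : Computes P a b e₀ e₁ p μ) : PolyTime μ := by
  have := P.finΛ
  have := P.finσ
  have : Fintype (Γ a) := Fintype.ofEquiv _ e₀
  let tm : FinTM2 := ⟨a, b, Γ, P.Λ, P.main, P.σ, P.init, P.m⟩
  refine ⟨⟨⟨tm, e₀.symm, e₁.symm⟩, p, fun w => ?_⟩⟩
  choose s hs h using h
  refine ⟨⟨s w, ?_⟩, hs w⟩
  change (flip bind (step P.m))^[s w]
    (some ⟨some P.main, P.init, (initList tm (w.1.map e₀)).stk⟩) =
    some ⟨none, P.init, (haltList tm ((μ w).1.map e₁)).stk⟩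
  rw [initList_stk, haltList_stk]
  exact Steps.iff_iterate.1 (h w)

theorem PolyTime.exists_computes {μ : Word → Word} (h : PolyTime μ) :
    ∃ (K : Type) (_ : DecidableEq K) (_ : Fintype K) (Γ : K → Type) (P : Prog K Γ) (a b : K)
      (e₀ : Bool ≃ Γ a) (e₁ : Bool ≃ Γ b) (p : Polynomial ℕ), Computes P a b e₀ e₁ p μ := by
  obtain ⟨⟨⟨tm, e₀, e₁⟩, p, h⟩⟩ := h
  refine ⟨tm.K, tm.kDecidableEq, tm.kFin, tm.Γ,
    @Prog.mk _ _ tm.Λ tm.ΛFin tm.main tm.σ tm.σFin tm.initialState tm.m,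
    tm.k₀, tm.k₁, e₀.symm, e₁.symm, p, fun w => ?_⟩
  obtain ⟨⟨s, h⟩, hs⟩ := h w
  refine ⟨s, hs, Steps.iff_iterate.2 ?_⟩
  change (flip bind (step tm.m))^[s]
    (some ⟨some tm.main, tm.initialState, (initList tm (w.1.map e₀.symm)).stk⟩) =
    some ⟨none, tm.initialState, (haltList tm ((μ w).1.map e₁.symm)).stk⟩ at h
  rwa [initList_stk, haltList_stk] at h

theorem Computes.exists_length_le {K : Type} [DecidableEq K] {Γ : K → Type} {P : Prog K Γ} {a b : K}
    {e₀ : Bool ≃ Γ a} {e₁ : Bool ≃ Γ b} {p : Polynomial ℕ} {μ : Word → Word}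
    (h : Computes P a b e₀ e₁ p μ) :
    ∃ q : Polynomial ℕ, ∀ w, (μ w).1.length ≤ q.eval w.1.length := by
  obtain ⟨C, hC⟩ := P.exists_length_le
  -- The term `X` serves the case in which input and output share a stack; otherwise the output
  -- stack starts empty.
  refine ⟨.X + .C C * p, fun w => ?_⟩
  have := hC _ _ _ (h w) b
  rw [single_self, List.length_map] at this
  refine this.trans ?_
  simp only [Polynomial.eval_add, Polynomial.eval_X, Polynomial.eval_mul, Polynomial.eval_C]
  gcongr
  by_cases hab : b = a
  · subst hab; simp
  · simp [hab]

theorem eval_mono (p : Polynomial ℕ) {m n : ℕ} (h : m ≤ n) : p.eval m ≤ p.eval n := by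
  simp only [Polynomial.eval_eq_sum, Polynomial.sum]
  gcongr

/-- Alphabets of the stacks of two programs, and of one more stack of bits for every element
of `U`. -/
abbrev Joint {K L : Type} (Γ : K → Type) (Δ : L → Type) (U : Type) : K ⊕ L ⊕ U → Type :=
  Sum.elim Γ (Sum.elim Δ fun _ => Bool)

/-- The joint contents of the stacks. -/
def joint {K L U : Type} {Γ : K → Type} {Δ : L → Type} (A : ∀ k, List (Γ k)) (B : ∀ k, List (Δ k))
    (C : U → List Bool) : ∀ k, List (Joint Γ Δ U k)
  | .inl k => A k
  | .inr (.inl k) => B k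
  | .inr (.inr k) => C k

section joint

variable {K L U : Type} [DecidableEq K] [DecidableEq L] [DecidableEq U] {Γ : K → Type}
  {Δ : L → Type}

theorem Prog.Run.joint_left {P : Prog K Γ} {A A' : ∀ k, List (Γ k)} {t : ℕ} (h : P.Run A A' t)
    (B : ∀ k, List (Δ k)) (C : U → List Bool) :
    (Prog.lift (Γ := Joint Γ Δ U) Sum.inl P).Run (joint A B C) (joint A' B C) t :=
  Prog.Run.lift (Γ := Joint Γ Δ U) Sum.inl_injective h fun k' hk => by
    rcases k' with k | k | k
    · exact absurd rfl (hk k)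
    · rfl
    · rfl

theorem Prog.Run.joint_right {Q : Prog L Δ} {B B' : ∀ k, List (Δ k)} {t : ℕ} (h : Q.Run B B' t)
    (A : ∀ k, List (Γ k)) (C : U → List Bool) :
    (Prog.lift (Γ := Joint Γ Δ U) (fun k => .inr (.inl k)) Q).Run (joint A B C) (joint A B' C) t :=
  Prog.Run.lift (Γ := Joint Γ Δ U) (Sum.inr_injective.comp Sum.inl_injective) h fun k' hk => by
    rcases k' with k | k | k
    · rfl
    · exact absurd rfl (hk k)
    · rfl

theorem joint_single_left (a : K) (l : List (Γ a)) :
    joint (single a l) (fun k => ([] : List (Δ k))) (fun _ : U => []) =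
      single (Γ := Joint Γ Δ U) (.inl a) l := by
  refine eq_single single_self ?_
  rintro (k | k | k) h
  · exact single_of_ne (by simpa using h)
  · rfl
  · rfl

theorem joint_single_right (a : L) (l : List (Δ a)) :
    joint (fun k => ([] : List (Γ k))) (single a l) (fun _ : U => []) =
      single (Γ := Joint Γ Δ U) (.inr (.inl a)) l := by
  refine eq_single single_self ?_
  rintro (k | k | k) h
  · rfl
  · exact single_of_ne (by simpa using h)
  · rfl

end joint

/-- Moving a stack reverses it, so the intermediate word passes through an auxiliary stack. This
also translates between the two alphabets. -/
theorem PolyTime.comp {ν μ : Word → Word} (hν : PolyTime ν) (hμ : PolyTime μ) :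
    PolyTime (ν ∘ μ) := by
  obtain ⟨K, _, _, Γ, P, a, b, e₀, e₁, p, hP⟩ := hμ.exists_computes
  obtain ⟨L, _, _, Δ, Q, c, d, f₀, f₁, q, hQ⟩ := hν.exists_computes
  obtain ⟨r, hr⟩ := hP.exists_length_le
  refine .of_computes (K := K ⊕ L ⊕ Unit) (Γ := Joint Γ Δ Unit)
    (P := (P.lift Sum.inl).seq <| (Prog.move (.inl b) (.inr (.inr ())) e₁.symm id).seq <|
      (Prog.move (.inr (.inr ())) (.inr (.inl c)) id f₀).seq (Q.lift fun k => .inr (.inl k)))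
    (a := .inl a) (b := .inr (.inl d)) (e₀ := e₀) (e₁ := f₁)
    (p := p + ((r + 1) + ((r + 1) + q.comp r))) fun w => ?_
  have h1 := (hP w).joint_left (Δ := Δ) (U := Unit) (fun _ => []) (fun _ => [])
  have h4 := (hQ (μ w)).joint_right (Γ := Γ) (U := Unit) (fun _ => []) (fun _ => [])
  have h2 : (Prog.move (Γ := Joint Γ Δ Unit) (.inl b) (.inr (.inr ())) e₁.symm id).Run
      (joint (single b ((μ w).1.map e₁)) (fun _ => []) (fun _ => []))
      (joint (fun _ => []) (fun _ => []) (fun _ => (μ w).1.reverse)) (r.eval w.1.length + 1) := by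
    refine (Prog.run_move (by simp) _ _ ?_ ?_ ?_).mono ?_
    · rfl
    · simp [joint]
      exact (List.append_nil _).symm
    · rintro (k | k | k) h h' <;> simp_all [joint]
    · simpa [joint] using hr w
  have h3 : (Prog.move (Γ := Joint Γ Δ Unit) (.inr (.inr ())) (.inr (.inl c)) id f₀).Run
      (joint (fun _ => []) (fun _ => []) (fun _ => (μ w).1.reverse))
      (joint (fun _ => []) (single c ((μ w).1.map f₀)) (fun _ => [])) (r.eval w.1.length + 1) := by
    refine (Prog.run_move (by simp) _ _ ?_ ?_ ?_).mono ?_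
    · rfl
    · simp [joint]
      exact (List.append_nil _).symm
    · rintro (k | k | k) h h' <;> simp_all [joint]
    · simpa [joint] using hr w
  have := h1.seq (h2.seq (h3.seq h4))
  rw [joint_single_left, joint_single_right] at this
  refine this.mono ?_
  simp only [Polynomial.eval_add, Polynomial.eval_one, Polynomial.eval_comp]
  gcongr
  exact eval_mono q (hr w)

/-- Concatenation of strings. -/
def Word.append (v w : Word) : Word := ⟨v.1 ++ w.1, by simp [v.2]⟩

theorem PolyTime.append {μ ν : Word → Word} (hμ : PolyTime μ) (hν : PolyTime ν) :
    PolyTime fun w => (μ w).append (ν w) := by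
  obtain ⟨K, _, _, Γ, P, a, b, e₀, e₁, p, hP⟩ := hμ.exists_computes
  obtain ⟨L, _, _, Δ, Q, c, d, f₀, f₁, q, hQ⟩ := hν.exists_computes
  obtain ⟨r, hr⟩ := hP.exists_length_le
  obtain ⟨s, hs⟩ := hQ.exists_length_le
  let io : K ⊕ L ⊕ Bool := .inr (.inr false)
  let aux : K ⊕ L ⊕ Bool := .inr (.inr true)
  -- In `U x y` the stack `io` holds `x` and `aux` holds `y`.
  let U (x y : List Bool) : Bool → List Bool := fun b => cond b y x
  refine .of_computes (K := K ⊕ L ⊕ Bool) (Γ := Joint Γ Δ Bool)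
    -- Both programs run on copies of the input. The output of the second is stored first, since the
    -- other one has to lie on top of it.
    (P := (Prog.move io aux id id).seq <| (Prog.dup aux (.inl a) (.inr (.inl c)) id e₀ f₀).seq <|
      (P.lift Sum.inl).seq <| (Q.lift fun k => .inr (.inl k)).seq <|
      (Prog.move (.inr (.inl d)) aux f₁.symm id).seq <| (Prog.move aux io id id).seq <|
      (Prog.move (.inl b) aux e₁.symm id).seq <| Prog.move aux io id id)
    (a := io) (b := io) (e₀ := Equiv.refl _) (e₁ := Equiv.refl _)
    (p := (.X + 1) + ((.X + 1) + (p + (q + ((s + 1) + ((s + 1) + ((r + 1) + (r + 1))))))))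
    fun w => ?_
  have h1 : (Prog.move (Γ := Joint Γ Δ Bool) io aux id id).Run
      (joint (fun _ => []) (fun _ => []) (U w.1 []))
      (joint (fun _ => []) (fun _ => []) (U [] w.1.reverse)) (w.1.length + 1) := by
    refine (Prog.run_move (by simp [io, aux]) _ _ ?_ ?_ ?_).mono ?_
    · rfl
    · simp [joint, io, aux, U]
      exact (List.append_nil _).symm
    · rintro (k | k | _ | _) h h' <;> simp_all [joint, io, aux]
    · simp [joint, io, U]
  have h2 : (Prog.dup (Γ := Joint Γ Δ Bool) aux (.inl a) (.inr (.inl c)) id e₀ f₀).Run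
      (joint (fun _ => []) (fun _ => []) (U [] w.1.reverse))
      (joint (single a (w.1.map e₀)) (single c (w.1.map f₀)) (U [] [])) (w.1.length + 1) := by
    refine (Prog.run_dup (by simp [aux]) (by simp [aux]) (by simp) _ _ _ ?_ ?_ ?_ ?_).mono ?_
    · rfl
    · simp [joint, aux, U]
      exact (List.append_nil _).symm
    · simp [joint, aux, U]
      exact (List.append_nil _).symm
    · rintro (k | k | _ | _) h h' h'' <;> simp_all [joint, aux, U]
    · simp [joint, aux, U]
  have h3 := (hP w).joint_left (single c (w.1.map f₀)) (U [] [])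
  have h4 := (hQ w).joint_right (single b ((μ w).1.map e₁)) (U [] [])
  have h5 : (Prog.move (Γ := Joint Γ Δ Bool) (.inr (.inl d)) aux f₁.symm id).Run
      (joint (single b ((μ w).1.map e₁)) (single d ((ν w).1.map f₁)) (U [] []))
      (joint (single b ((μ w).1.map e₁)) (fun _ => []) (U [] (ν w).1.reverse))
      (s.eval w.1.length + 1) := by
    refine (Prog.run_move (by simp [aux]) _ _ ?_ ?_ ?_).mono ?_
    · rfl
    · simp [joint, aux, U]
      exact (List.append_nil _).symm
    · rintro (k | k | _ | _) h h' <;> simp_all [joint, aux, U]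
    · simpa [joint] using hs w
  have h6 : (Prog.move (Γ := Joint Γ Δ Bool) aux io id id).Run
      (joint (single b ((μ w).1.map e₁)) (fun _ => []) (U [] (ν w).1.reverse))
      (joint (single b ((μ w).1.map e₁)) (fun _ => []) (U (ν w).1 []))
      (s.eval w.1.length + 1) := by
    refine (Prog.run_move (by simp [io, aux]) _ _ ?_ ?_ ?_).mono ?_
    · rfl
    · simp [joint, io, aux, U]
      exact (List.append_nil _).symm
    · rintro (k | k | _ | _) h h' <;> simp_all [joint, io, aux]
    · simpa [joint, aux, U] using hs w
  have h7 : (Prog.move (Γ := Joint Γ Δ Bool) (.inl b) aux e₁.symm id).Run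
      (joint (single b ((μ w).1.map e₁)) (fun _ => []) (U (ν w).1 []))
      (joint (fun _ => []) (fun _ => []) (U (ν w).1 (μ w).1.reverse))
      (r.eval w.1.length + 1) := by
    refine (Prog.run_move (by simp [aux]) _ _ ?_ ?_ ?_).mono ?_
    · rfl
    · simp [joint, aux, U]
      exact (List.append_nil _).symm
    · rintro (k | k | _ | _) h h' <;> simp_all [joint, aux, U]
    · simpa [joint] using hr w
  have h8 : (Prog.move (Γ := Joint Γ Δ Bool) aux io id id).Run
      (joint (fun _ => []) (fun _ => []) (U (ν w).1 (μ w).1.reverse))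
      (joint (fun _ => []) (fun _ => []) (U ((μ w).1 ++ (ν w).1) []))
      (r.eval w.1.length + 1) := by
    refine (Prog.run_move (by simp [io, aux]) _ _ ?_ ?_ ?_).mono ?_
    · rfl
    · simp [joint, io, aux, U]
      rfl
    · rintro (k | k | _ | _) h h' <;> simp_all [joint, io, aux]
    · simpa [joint, aux, U] using hr w
  have hU : ∀ l, joint (fun k => ([] : List (Γ k))) (fun k => ([] : List (Δ k))) (U l []) =
      single (Γ := Joint Γ Δ Bool) io (l.map (Equiv.refl Bool)) := by
    intro l
    refine eq_single (List.map_id l).symm ?_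
    rintro (k | k | _ | _) h
    · rfl
    · rfl
    · exact absurd rfl h
    · rfl
  have := h1.seq (h2.seq (h3.seq (h4.seq (h5.seq (h6.seq (h7.seq h8))))))
  rw [hU, hU] at this
  exact this.mono (by simp)

theorem PolyTime.const (v : Word) : PolyTime fun _ => v := by
  refine .of_computes (K := Unit) (Γ := fun _ => Bool)
    (P := (Prog.clear ()).seq (Prog.write () v.1.reverse)) (a := ()) (b := ())
    (e₀ := Equiv.refl _) (e₁ := Equiv.refl _) (p := (.X + 1) + 1) fun w => ?_
  have h1 := Prog.run_clear (Γ := fun _ => Bool) (a := ()) (S := single () w.1)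
    (S' := fun _ => []) rfl (fun k h => absurd rfl h)
  have h2 := Prog.run_write (Γ := fun _ => Bool) (a := ()) v.1.reverse (S := fun _ => [])
    (S' := single () v.1) (by simp) (fun k h => absurd rfl h)
  simpa using h1.seq h2

theorem PolyTime.id : PolyTime _root_.id := ⟨idComputableInPolyTime _⟩

/-! ### Isolating the expression at the front of a string -/

/-- The `j`-th variable of every block becomes the one with number `2 * j + 1`. -/
def Expr.odd : Expr → Expr
  | .var i j => .var i (2 * j + 1)
  | .not e => .not e.odd
  | .and e₁ e₂ => .and e₁.odd e₂.odd
  | .or e₁ e₂ => .or e₁.odd e₂.odd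

/-- The part of a string that `readNat` reads, properly terminated. -/
def copyNat : List Bool → List Bool
  | true :: b :: s => true :: b :: copyNat s
  | _ => [false]

theorem readNat_copyNat (s u : List Bool) : readNat (copyNat s ++ u) = ((readNat s).1, u) := by
  induction s using copyNat.induct with
  | case1 b s ih => simp [copyNat, readNat, ih]
  | case2 s h =>
    match s, h with
    | [], _ => simp [copyNat, readNat]
    | [true], _ => simp [copyNat, readNat]
    | false :: s, _ => simp [copyNat, readNat]
    | true :: b :: s, h => exact absurd rfl (h b s)

/-- The `+ 1` allows for a terminator that the input lacks. -/
theorem length_copyNat_le (s : List Bool) :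
    (copyNat s).length + (readNat s).2.length ≤ s.length + 1 := by
  induction s using copyNat.induct with
  | case1 b s ih => simp only [copyNat, readNat, List.length_cons]; omega
  | case2 s h =>
    match s, h with
    | [], _ => simp [copyNat, readNat]
    | [true], _ => simp [copyNat, readNat]
    | false :: s, _ => simp [copyNat, readNat]; omega
    | true :: b :: s, h => exact absurd rfl (h b s)

theorem length_readNat_le (s : List Bool) : (readNat s).2.length ≤ s.length := by
  induction s using copyNat.induct with
  | case1 b s ih => simp only [readNat, List.length_cons]; omega
  | case2 s h =>
    match s, h with
    | [], _ => simp [readNat]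
    | [true], _ => simp [readNat]
    | false :: s, _ => simp [readNat]
    | true :: b :: s, h => exact absurd rfl (h b s)

theorem length_readExpr_le (k : ℕ) (s : List Bool) : (readExpr k s).2.length ≤ s.length := by
  induction k generalizing s with
  | zero => simp [readExpr]
  | succ k ih =>
    match s with
    | [] => simp [readExpr]
    | [_] => simp [readExpr]
    | false :: false :: s =>
      have h1 := length_readNat_le s
      have h2 := length_readNat_le (readNat s).2
      simp only [readExpr, List.length_cons]; omega
    | false :: true :: s =>
      have h1 := ih s
      simp only [readExpr, List.length_cons]; omega
    | true :: false :: s =>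
      have h1 := ih s
      have h2 := ih (readExpr k s).2
      simp only [readExpr, List.length_cons]; omega
    | true :: true :: s =>
      have h1 := ih s
      have h2 := ih (readExpr k s).2
      simp only [readExpr, List.length_cons]; omega

/-- Every level of the recursion consumes two letters, so fuel can run out only on the empty string,
where the default value is returned anyway. -/
theorem readExpr_congr_fuel {k l : ℕ} {s : List Bool} (hk : s.length ≤ k) (hl : s.length ≤ l) :
    readExpr k s = readExpr l s := by
  induction k generalizing s l with
  | zero =>
    obtain rfl : s = [] := by simpa using hk
    simp [readExpr]
  | succ k ih =>
    cases l with
    | zero =>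
      obtain rfl : s = [] := by simpa using hl
      simp [readExpr]
    | succ l =>
      match s with
      | [] => simp [readExpr]
      | [_] => simp [readExpr]
      | false :: false :: s => simp [readExpr]
      | false :: true :: s =>
        simp only [List.length_cons] at hk hl
        simp only [readExpr, ih (s := s) (l := l) (by omega) (by omega)]
      | true :: false :: s =>
        simp only [List.length_cons] at hk hl
        have h := length_readExpr_le l s
        simp only [readExpr, ih (s := s) (l := l) (by omega) (by omega),
          ih (s := (readExpr l s).2) (l := l) (by omega) (by omega)]
      | true :: true :: s =>
        simp only [List.length_cons] at hk hl
        have h := length_readExpr_le l s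
        simp only [readExpr, ih (s := s) (l := l) (by omega) (by omega),
          ih (s := (readExpr l s).2) (l := l) (by omega) (by omega)]

-- A linear time parser with a stack of pending subexpressions

namespace Parser

/-- The stacks: the rest of the input; one letter for every subexpression that is still to be read;
the output in reverse. -/
inductive Stack
  | inp
  | todo
  | out
  deriving DecidableEq

instance : Fintype Stack := ⟨{.inp, .todo, .out}, fun k => by cases k <;> decide⟩

/-- The labels: read an expression, or one of the two numbers of a variable. -/
inductive Label
  | expr
  | num (second : Bool)
  deriving Fintype

abbrev State := Option Bool × Option Bool

abbrev St := Stmt (fun _ : Stack => Bool) Label State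

def emit (l : List Bool) (q : St) : St := l.foldr (fun b q => .push .out (fun _ => b) q) q

def jump (l : Label) : St := .load (fun _ => (none, none)) <| .goto fun _ => l

/-- End of a number. The second number of a variable gets one more digit. -/
def endNum : Bool → St
  -- The letter `false` ends the first number; `true, true` is a new least significant digit 1 of
  -- the second, which turns `j` into `2 * j + 1`.
  | false => emit [false, true, true] <| jump (.num true)
  | true => emit [false] <| jump .expr

/-- Each token settles one pending subexpression and creates as many as its connective has
arguments; the machine halts when none is pending. -/
def prog : Label → St
  | .expr => .pop .todo (fun _ o => (o, none)) <| .branch (fun s => s.1.isSome)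
      (.pop .inp (fun _ o => (o, none)) <| .pop .inp (fun s o => (s.1, o)) <|
        .branch (fun s => s.2.isSome)
          (.push .out (fun s => s.1.getD false) <| .push .out (fun s => s.2.getD false) <|
            .branch (fun s => s.1.getD false)
              (.push .todo (fun _ => false) <| .push .todo (fun _ => false) <| jump .expr)
              (.branch (fun s => s.2.getD false)
                (.push .todo (fun _ => false) <| jump .expr)
                (jump (.num false))))
          -- The input ends before a full token: the code of `var 0 1`, the renamed default `var 0
          -- 0`, is written.
          (emit [false, false, false, true, true, false] <| jump .expr))
      .halt
  | .num b => .pop .inp (fun _ o => (o, none)) <| .branch (fun s => s.1.getD false)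
      (.pop .inp (fun s o => (s.1, o)) <| .branch (fun s => s.2.isSome)
        (.push .out (fun _ => true) <| .push .out (fun s => s.2.getD false) <| jump (.num b))
        (endNum b))
      (endNum b)

def tapes (s c r : List Bool) : Stack → List Bool
  | .inp => s
  | .todo => c
  | .out => r

section

variable (s c r l : List Bool)

@[simp]
theorem tapes_inp : tapes s c r .inp = s := rfl

@[simp]
theorem tapes_todo : tapes s c r .todo = c := rfl

@[simp]
theorem tapes_out : tapes s c r .out = r := rfl

@[simp]
theorem update_inp : Function.update (tapes s c r) .inp l = tapes l c r := by
  funext k; cases k <;> rfl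

@[simp]
theorem update_todo : Function.update (tapes s c r) .todo l = tapes s l r := by
  funext k; cases k <;> rfl

@[simp]
theorem update_out : Function.update (tapes s c r) .out l = tapes s c l := by
  funext k; cases k <;> rfl

end

def cfg (l : Label) (s c r : List Bool) : Cfg (fun _ : Stack => Bool) Label State :=
  ⟨some l, (none, none), tapes s c r⟩

def next : Bool → Label
  | false => .num true
  | true => .expr

def extra : Bool → List Bool
  | false => [true, true]
  | true => []

theorem steps_num (b : Bool) (s c r : List Bool) : ∃ t, t + (readNat s).2.length ≤ s.length + 1 ∧
    Steps prog t (cfg (.num b) s c r)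
      (cfg (next b) (readNat s).2 c (extra b ++ (copyNat s).reverse ++ r)) := by
  induction s using copyNat.induct generalizing r with
  | case1 a s ih =>
    obtain ⟨t, ht, h⟩ := ih (a :: true :: r)
    refine ⟨t + 1, ?_, .head (c' := cfg (.num b) s c (a :: true :: r)) ?_ ?_⟩
    · simp only [readNat, List.length_cons]; omega
    · simp [cfg, prog, jump]
    · simpa [copyNat, readNat] using h
  | case2 s h =>
    refine ⟨1, ?_, .head ?_ (.refl _)⟩
    · have := length_copyNat_le s
      have h1 : (copyNat s).length = 1 := by
        rw [copyNat]; · rfl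
        exact h
      omega
    · match s, h with
      | [], _ => cases b <;> simp [copyNat, readNat, cfg, prog, endNum, emit, jump, next, extra]
      | [true], _ => cases b <;> simp [copyNat, readNat, cfg, prog, endNum, emit, jump, next, extra]
      | false :: s, _ =>
        cases b <;> simp [copyNat, readNat, cfg, prog, endNum, emit, jump, next, extra]
      | true :: b :: s, h => exact absurd rfl (h b s)

/-- What the parser achieves on the expression at the front of `s`, which it turns into `o`. -/
structure Spec (e : Expr) (s rest o : List Bool) : Prop where
  -- A missing expression takes 1 step and 6 letters of output without using input, hence the
  -- constants here and in `length`. The factor 4 there lets the two letters of a binary token pay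
  -- for their copy and for 6 more letters, as it has two arguments.
  steps : ∀ c r, ∃ t, t + 2 * rest.length ≤ 2 * s.length + 1 ∧
    Steps prog t (cfg .expr s (false :: c) r) (cfg .expr rest c (o.reverse ++ r))
  length : o.length + 4 * rest.length ≤ 4 * s.length + 6
  ne_nil : o ≠ []
  read : ∀ k u, o.length ≤ k → readExpr k (o ++ u) = (e.odd, u)

theorem Spec.missing {s : List Bool} (hs : s.length ≤ 1) :
    Spec (.var 0 0) s [] [false, false, false, true, true, false] where
  steps c r := by
    refine ⟨1, by simp, .head ?_ (.refl _)⟩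
    match s, hs with
    | [], _ => simp [cfg, prog, emit, jump]
    | [_], _ => simp [cfg, prog, emit, jump]
  length := by simp
  ne_nil := by simp
  read k u h := by
    obtain _ | k := k
    · simp at h
    · simp [readExpr, readNat, Expr.odd]

/-- The second letter `b` of the token distinguishes `and` from `or`, so one proof serves both. -/
theorem Spec.binary {s rest₁ rest₂ o₁ o₂ : List Bool} {e₁ e₂ e : Expr} (b : Bool)
    (he : ∀ k s, readExpr (k + 1) (true :: b :: s) = (cond b
      (.or (readExpr k s).1 (readExpr k (readExpr k s).2).1)
      (.and (readExpr k s).1 (readExpr k (readExpr k s).2).1), (readExpr k (readExpr k s).2).2))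
    (he' : e.odd = cond b (.or e₁.odd e₂.odd) (.and e₁.odd e₂.odd))
    (h₁ : Spec e₁ s rest₁ o₁) (h₂ : Spec e₂ rest₁ rest₂ o₂) :
    Spec e (true :: b :: s) rest₂ (true :: b :: (o₁ ++ o₂)) where
  steps c r := by
    obtain ⟨t₁, ht₁, h₁⟩ := h₁.steps (false :: c) (b :: true :: r)
    obtain ⟨t₂, ht₂, h₂⟩ := h₂.steps c (o₁.reverse ++ b :: true :: r)
    refine ⟨t₁ + t₂ + 1, ?_, .head (c' := cfg .expr s (false :: false :: c) (b :: true :: r)) ?_ ?_⟩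
    · simp only [List.length_cons]; omega
    · simp [cfg, prog, jump]
    · simpa using h₁.trans h₂
  length := by
    have := h₁.length
    have := h₂.length
    simp only [List.length_cons, List.length_append]; omega
  ne_nil := by simp
  read k u h := by
    obtain _ | k := k
    · simp at h
    · simp only [List.length_cons, List.length_append] at h
      rw [List.cons_append, List.cons_append, List.append_assoc, he, h₁.read k _ (by omega),
        h₂.read k _ (by omega), he']

theorem exists_spec (k : ℕ) (s : List Bool) (hk : s.length ≤ k) :
    ∃ o, Spec (readExpr k s).1 s (readExpr k s).2 o := by
  induction k generalizing s with
  | zero =>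
    obtain rfl : s = [] := by simpa using hk
    exact ⟨_, .missing (by simp)⟩
  | succ k ih =>
    match s with
    | [] => exact ⟨_, .missing (by simp)⟩
    | [_] =>
      simp only [readExpr]
      exact ⟨_, .missing (by simp)⟩
    | false :: false :: s =>
      have hl := length_copyNat_le s
      have hl' := length_copyNat_le (readNat s).2
      have hr := length_readNat_le s
      have hr' := length_readNat_le (readNat s).2
      simp only [readExpr]
      refine ⟨false :: false :: (copyNat s ++ true :: true :: copyNat (readNat s).2), ⟨?_, ?_, ?_, ?_⟩⟩
      · intro c r
        obtain ⟨t₁, ht₁, h₁⟩ := steps_num false s c (false :: false :: r)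
        obtain ⟨t₂, ht₂, h₂⟩ := steps_num true (readNat s).2 c
          (extra false ++ (copyNat s).reverse ++ false :: false :: r)
        refine ⟨t₁ + t₂ + 1, ?_, .head (c' := cfg (.num false) s c (false :: false :: r)) ?_ ?_⟩
        · simp only [List.length_cons]; omega
        · simp [cfg, prog, jump]
        · simpa [extra, next] using h₁.trans h₂
      · simp only [List.length_cons, List.length_append]; omega
      · simp
      · intro k u h
        obtain _ | k := k
        · simp at h
        · simp [readExpr, readNat_copyNat, readNat, Expr.odd, add_comm]
    | false :: true :: s =>
      simp only [List.length_cons] at hk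
      obtain ⟨o, ho⟩ := ih s (by omega)
      simp only [readExpr]
      refine ⟨false :: true :: o, ⟨?_, ?_, ?_, ?_⟩⟩
      · intro c r
        obtain ⟨t, ht, h⟩ := ho.steps c (true :: false :: r)
        refine ⟨t + 1, ?_, .head (c' := cfg .expr s (false :: c) (true :: false :: r)) ?_ ?_⟩
        · simp only [List.length_cons]; omega
        · simp [cfg, prog, jump]
        · simpa using h
      · have := ho.length
        simp only [List.length_cons]; omega
      · simp
      · intro k u h
        obtain _ | k := k
        · simp at h
        · simp only [List.length_cons] at h
          simp [readExpr, ho.read k u (by omega), Expr.odd]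
    | true :: false :: s =>
      simp only [List.length_cons] at hk
      obtain ⟨o₁, h₁⟩ := ih s (by omega)
      obtain ⟨o₂, h₂⟩ := ih (readExpr k s).2 ((length_readExpr_le k s).trans (by omega))
      exact ⟨_, .binary false (fun _ _ => by simp [readExpr]) (by simp [readExpr, Expr.odd]) h₁ h₂⟩
    | true :: true :: s =>
      simp only [List.length_cons] at hk
      obtain ⟨o₁, h₁⟩ := ih s (by omega)
      obtain ⟨o₂, h₂⟩ := ih (readExpr k s).2 ((length_readExpr_le k s).trans (by omega))
      exact ⟨_, .binary true (fun _ _ => by simp [readExpr]) (by simp [readExpr, Expr.odd]) h₁ h₂⟩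

end Parser

/-- The expression that a string encodes, with its variables renamed, can be isolated in polynomial
time. -/
theorem exists_isolate : ∃ τ : Word → Word, PolyTime τ ∧ ∀ (w : Word) (k : ℕ) (u : List Bool),
    (τ w).1.length ≤ k → readExpr k ((τ w).1 ++ u) = ((readExpr w.1.length w.1).1.odd, u) := by
  choose τ hτ using fun w : Word => Parser.exists_spec w.1.length w.1 le_rfl
  refine ⟨fun w => ⟨τ w, (hτ w).ne_nil⟩, ?_, fun w => (hτ w).read⟩
  let P : Prog Parser.Stack (fun _ => Bool) := ⟨Parser.Label, .expr, _, (none, none), Parser.prog⟩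
  -- One expression is pending at the start. What follows it in the input is discarded, and the last
  -- move undoes the reversal of the output.
  refine .of_computes (P := (Prog.write .todo [false]).seq <| P.seq <|
      (Prog.clear .inp).seq <| Prog.move .out .inp id id)
    (a := .inp) (b := .inp) (e₀ := Equiv.refl _) (e₁ := Equiv.refl _)
    (p := 1 + ((2 * .X + 2) + ((.X + 1) + (4 * .X + 7)))) fun w => ?_
  have hs : ∀ l : List Bool, Parser.tapes l [] [] =
      single (Γ := fun _ => Bool) Parser.Stack.inp (l.map (Equiv.refl Bool)) := by
    intro l
    refine eq_single (List.map_id l).symm ?_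
    rintro (_ | _ | _) h <;> first | rfl | exact absurd rfl h
  rw [← hs, ← hs]
  have hl := length_readExpr_le w.1.length w.1
  obtain ⟨t, ht, h⟩ := (hτ w).steps [] []
  have h1 : (Prog.write (Γ := fun _ => Bool) Parser.Stack.todo [false]).Run
      (Parser.tapes w.1 [] []) (Parser.tapes w.1 [false] []) 1 := by
    refine Prog.run_write _ rfl ?_
    rintro (_ | _ | _) h <;> first | rfl | exact absurd rfl h
  have h2 : P.Run (Parser.tapes w.1 [false] [])
      (Parser.tapes (readExpr w.1.length w.1).2 [] (τ w).reverse) (2 * w.1.length + 2) := by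
    refine ⟨t + 1, by omega, h.trans (.head ?_ (.refl _))⟩
    simp [Parser.cfg, Parser.prog, P]
  have h3 : (Prog.clear (Γ := fun _ => Bool) Parser.Stack.inp).Run
      (Parser.tapes (readExpr w.1.length w.1).2 [] (τ w).reverse)
      (Parser.tapes [] [] (τ w).reverse) (w.1.length + 1) := by
    refine (Prog.run_clear rfl ?_).mono (by simpa using hl)
    rintro (_ | _ | _) h <;> first | rfl | exact absurd rfl h
  have h4 : (Prog.move (Γ := fun _ => Bool) Parser.Stack.out .inp id id).Run
      (Parser.tapes [] [] (τ w).reverse) (Parser.tapes (τ w) [] [])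
      (4 * w.1.length + 7) := by
    refine (Prog.run_move (by simp) _ _ rfl (by simp) ?_).mono ?_
    · rintro (_ | _ | _) h h' <;> first | rfl | exact absurd rfl h | exact absurd rfl h'
    · have := (hτ w).length
      simp only [Parser.tapes_out, List.length_reverse]
      omega
  refine (h1.seq (h2.seq (h3.seq h4))).mono (by simp)

/-! ### Quantification over infinite assignments -/

/-- The assignment with first row `x`, followed by the rows of `v`. -/
def consRow (x : ℕ → Bool) (v : ℕ → ℕ → Bool) : ℕ → ℕ → Bool
  | 0 => x
  | i + 1 => v i

mutual

/-- `IsSat` for functions of `n` infinite blocks; the remaining blocks are read as `0`. -/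
def InfSat : (n : ℕ) → ((ℕ → ℕ → Bool) → Bool) → Prop
  | 0, F => F (fun _ _ => false) = true
  | n + 1, F => ∃ x : ℕ → Bool, InfTaut n (fun v => F (consRow x v))

/-- `IsTaut` for functions of `n` infinite blocks; the remaining blocks are read as `0`. -/
def InfTaut : (n : ℕ) → ((ℕ → ℕ → Bool) → Bool) → Prop
  | 0, F => F (fun _ _ => false) = true
  | n + 1, F => ∀ x : ℕ → Bool, InfSat n (fun v => F (consRow x v))

end

theorem infSat_not_iff_and (n : ℕ) : ∀ F : (ℕ → ℕ → Bool) → Bool,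
    (InfSat n (fun v => !F v) ↔ ¬InfTaut n F) ∧ (InfTaut n (fun v => !F v) ↔ ¬InfSat n F) := by
  induction n with
  | zero => simp [InfSat, InfTaut]
  | succ n ih =>
    intro F
    simp only [InfSat, InfTaut, not_forall, not_exists]
    exact ⟨exists_congr fun x => (ih _).2, forall_congr' fun x => (ih _).1⟩

theorem infSat_not_iff (n : ℕ) (F : (ℕ → ℕ → Bool) → Bool) :
    InfSat n (fun v => !F v) ↔ ¬InfTaut n F := (infSat_not_iff_and n F).1

theorem infTaut_not_iff (n : ℕ) (F : (ℕ → ℕ → Bool) → Bool) :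
    InfTaut n (fun v => !F v) ↔ ¬InfSat n F := (infSat_not_iff_and n F).2

/-- The part of an assignment that is visible after renaming with `Expr.odd`. -/
def oddPart (v : ℕ → ℕ → Bool) (i j : ℕ) : Bool := v i (2 * j + 1)

theorem eval_odd (e : Expr) (v : ℕ → ℕ → Bool) : e.odd.eval v = e.eval (oddPart v) := by
  induction e <;> simp_all [Expr.odd, Expr.eval, oddPart]

theorem oddPart_consRow (x : ℕ → Bool) (v : ℕ → ℕ → Bool) :
    oddPart (consRow x v) = consRow (fun j => x (2 * j + 1)) (oddPart v) := by
  funext i j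
  cases i <;> rfl

/-- The row with first bit `b` and the bits of `x` at the odd places. -/
def spread (b : Bool) (x : ℕ → Bool) (j : ℕ) : Bool := if j = 0 then b else x (j / 2)

theorem spread_odd (b : Bool) (x : ℕ → Bool) : (fun j => spread b x (2 * j + 1)) = x := by
  funext j
  simp only [spread]
  rw [if_neg (by omega)]
  congr 1
  omega

/-- Every row is the odd part of some row, by `spread_odd`, so quantifying over rows or over their
odd parts is the same. -/
theorem inf_oddPart_iff (n : ℕ) : ∀ F : (ℕ → ℕ → Bool) → Bool,
    (InfSat n (fun v => F (oddPart v)) ↔ InfSat n F) ∧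
      (InfTaut n (fun v => F (oddPart v)) ↔ InfTaut n F) := by
  induction n with
  | zero => intro F; exact ⟨Iff.rfl, Iff.rfl⟩
  | succ n ih =>
    intro F
    simp only [InfSat, InfTaut, oddPart_consRow]
    have h := fun x => ih (fun v => F (consRow x v))
    constructor
    · constructor
      · rintro ⟨x, hx⟩
        exact ⟨_, (h _).2.1 hx⟩
      · rintro ⟨x, hx⟩
        refine ⟨spread false x, (h _).2.2 ?_⟩
        rwa [spread_odd]
    · constructor
      · intro H x
        have := (h _).1.1 (H (spread false x))
        rwa [spread_odd] at this
      · intro H x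
        exact (h _).1.2 (H _)

/-! ### Block lengths do not matter -/

/-- `F` is the extension of `f` to infinite blocks. -/
def Extends {n : ℕ} (f : BlockFun n) (F : (ℕ → ℕ → Bool) → Bool) : Prop :=
  ∀ v : ℕ → ℕ → Bool, f.toFun (fun i j => v i j) = F (fun i j => if i < n then v i j else false)

theorem Extends.fix {n : ℕ} {f : BlockFun (n + 1)} {F : (ℕ → ℕ → Bool) → Bool} (h : Extends f F)
    (x : ℕ → Bool) : Extends (f.fix fun j => x j) (fun v => F (consRow x v)) := by
  intro v
  refine Eq.trans (congrArg f.toFun ?_) ((h (consRow x v)).trans (congrArg F ?_))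
  · funext i
    refine Fin.cases ?_ (fun i => ?_) i <;> rfl
  · funext i j
    cases i
    · simp [consRow]
    · simp [consRow]

/-- Extension of a finite block by `0`. -/
def padRow {m : ℕ} (x : Fin m → Bool) (j : ℕ) : Bool := if h : j < m then x ⟨j, h⟩ else false

theorem padRow_coe {m : ℕ} (x : Fin m → Bool) : (fun j : Fin m => padRow x j) = x := by
  funext j
  simp [padRow]

/-- Infinite rows are restricted and finite ones padded by 0. The two claims need each other, since
the quantifiers alternate. -/
theorem Extends.iff_and {n : ℕ} : ∀ {f : BlockFun n} {F : (ℕ → ℕ → Bool) → Bool}, Extends f F →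
    (IsSat n f ↔ InfSat n F) ∧ (IsTaut n f ↔ InfTaut n F) := by
  induction n with
  | zero =>
    intro f F h
    have h := h (fun _ _ => false)
    simp only [not_lt_zero, if_false] at h
    simp only [IsSat, IsTaut, InfSat, InfTaut]
    rw [← h]
    have : (fun (i : Fin 0) (j : Fin (f.len i)) => false) = fun i => i.elim0 := by
      funext i; exact i.elim0
    rw [this]
    exact ⟨Iff.rfl, Iff.rfl⟩
  | succ n ih =>
    intro f F h
    simp only [IsSat, IsTaut, InfSat, InfTaut]
    constructor
    · constructor
      · rintro ⟨x, hx⟩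
        rw [← padRow_coe x] at hx
        exact ⟨_, (ih (h.fix _)).2.1 hx⟩
      · rintro ⟨x, hx⟩
        exact ⟨_, (ih (h.fix x)).2.2 hx⟩
    · constructor
      · intro H x
        exact (ih (h.fix x)).1.1 (H _)
      · intro H x
        have := (ih (h.fix _)).1.2 (H (padRow x))
        rwa [padRow_coe] at this

theorem Extends.mem_firstBits_iff {n : ℕ} {f : BlockFun (n + 1)} {F : (ℕ → ℕ → Bool) → Bool}
    (h : Extends f F) (b : Bool) :
    b ∈ firstBits f ↔ ∃ x : ℕ → Bool, x 0 = b ∧ InfTaut n (fun v => F (consRow x v)) := by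
  constructor
  · rintro ⟨x, hx, rfl⟩
    rw [← padRow_coe x] at hx
    refine ⟨padRow x, ?_, (h.fix _).iff_and.2.1 hx⟩
    simp [padRow, f.len_pos 0]
  · rintro ⟨x, rfl, hx⟩
    exact ⟨_, (h.fix x).iff_and.2.2 hx, rfl⟩

theorem eval_congr (e : Expr) {u v : ℕ → ℕ → Bool} (h : ∀ i j, j < e.bound i → u i j = v i j) :
    e.eval u = e.eval v := by
  induction e with
  | var i j => exact h i j (by simp [Expr.bound])
  | not e ih => simp only [Expr.eval, ih h]
  | and e₁ e₂ ih₁ ih₂ =>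
    simp only [Expr.eval, ih₁ fun i j hj => h i j (lt_max_of_lt_left hj),
      ih₂ fun i j hj => h i j (lt_max_of_lt_right hj)]
  | or e₁ e₂ ih₁ ih₂ =>
    simp only [Expr.eval, ih₁ fun i j hj => h i j (lt_max_of_lt_left hj),
      ih₂ fun i j hj => h i j (lt_max_of_lt_right hj)]

/-- The expression at the front of a string. -/
def exprOf (w : List Bool) : Expr := (readExpr w.length w).1

/-- `decode` makes each block long enough for all its variables that occur, so truncation is
invisible. Hence `SAT`, `coSAT` and `VAL` depend on the expression alone. -/
theorem extends_decode (n : ℕ) (w : List Bool) : Extends (decode n w) (exprOf w).eval := by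
  intro v
  refine eval_congr _ fun i j hj => ?_
  by_cases hi : i < n
  · have hj' : j < max 1 (max ((readExpr w.length w).1.bound i)
        (readNth i (readExpr w.length w).2)) :=
      lt_max_of_lt_right (lt_max_of_lt_left hj)
    simp [hi, hj']
  · simp [hi]

theorem SAT_eq_true_iff (n : ℕ) (w : Word) : SAT n w = true ↔ InfSat n (exprOf w.1).eval := by
  simp only [SAT, decide_eq_true_eq]
  exact (extends_decode n w.1).iff_and.1

theorem coSAT_eq_true_iff (n : ℕ) (w : Word) : coSAT n w = true ↔ InfTaut n (exprOf w.1).eval := by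
  simp only [coSAT, decide_eq_true_eq]
  exact (extends_decode n w.1).iff_and.2

/-- The first bits of the witnesses for `F`. -/
def infFirstBits (n : ℕ) (F : (ℕ → ℕ → Bool) → Bool) : Set Bool :=
  {b | ∃ x : ℕ → Bool, x 0 = b ∧ InfTaut n (fun v => F (consRow x v))}

/-- An answer is invalid only if it begins no witness while the other bit does; this covers the
failing promise too. -/
theorem mem_VAL_iff (n : ℕ) (w : Word) (b : Bool) : b ∈ (VAL (n + 1) w).1 ↔
    b ∈ infFirstBits n (exprOf w.1).eval ∨ (!b) ∉ infFirstBits n (exprOf w.1).eval := by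
  have h := (extends_decode (n + 1) w.1)
  have hb : ∀ b, b ∈ firstBits (decode (n + 1) w.1) ↔ b ∈ infFirstBits n (exprOf w.1).eval :=
    h.mem_firstBits_iff
  have hs : IsSat (n + 1) (decode (n + 1) w.1) ↔ ∃ b, b ∈ infFirstBits n (exprOf w.1).eval := by
    rw [h.iff_and.1, InfSat]
    exact ⟨fun ⟨x, hx⟩ => ⟨_, x, rfl, hx⟩, fun ⟨_, x, _, hx⟩ => ⟨x, hx⟩⟩
  simp only [VAL, promise]
  split_ifs with hP
  · rw [hs] at hP
    simp only [hb]
    refine ⟨.inl, fun H => H.elim id fun H => ?_⟩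
    obtain ⟨c, hc⟩ := hP
    cases b <;> cases c <;> simp_all
  · rw [hs, not_exists] at hP
    simp [hP]

/-! ### The reductions -/

theorem StrongRed.trans {φ ψ χ : PromiseProblem} (h₁ : StrongRed φ ψ) (h₂ : StrongRed ψ χ) :
    StrongRed φ χ := by
  obtain ⟨μ, hμ, h₁⟩ := h₁
  obtain ⟨ν, hν, h₂⟩ := h₂
  exact ⟨ν ∘ μ, hν.comp hμ, fun w => (h₂ _).trans (h₁ w)⟩

theorem StrongRed.refl (φ : PromiseProblem) : StrongRed φ φ := ⟨id, .id, fun _ => subset_rfl⟩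

theorem exprOf_and_cons (w : List Bool) :
    exprOf ([true, false, false, false, false, false] ++ w) = .and (.var 0 0) (exprOf w) := by
  simp only [exprOf, List.cons_append, List.nil_append, List.length_cons, readExpr, readNat]
  rw [readExpr_congr_fuel (l := w.length) (by omega) le_rfl]

theorem exprOf_or_not_cons (w : List Bool) :
    exprOf ([true, true, false, false, false, false, false, true] ++ w) =
      .or (.var 0 0) (.not (exprOf w)) := by
  simp only [exprOf, List.cons_append, List.nil_append, List.length_cons, readExpr, readNat]
  rw [readExpr_congr_fuel (l := w.length) (by omega) le_rfl]

theorem not_infTaut_infSat_false (n : ℕ) :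
    ¬InfTaut n (fun _ => false) ∧ ¬InfSat n (fun _ => false) := by
  induction n with
  | zero => simp [InfTaut, InfSat]
  | succ n ih => simp [InfTaut, InfSat, ih]

theorem infSat_and_iff (n : ℕ) (F : (ℕ → ℕ → Bool) → Bool) :
    InfSat (n + 1) (fun v => v 0 0 && F v) ↔ true ∈ infFirstBits n F := by
  rw [InfSat]
  refine exists_congr fun x => ?_
  change InfTaut n (fun v => x 0 && F (consRow x v)) ↔ _
  cases x 0
  · simp [not_infTaut_infSat_false]
  · simp

theorem infSat_not_and_iff (n : ℕ) (F : (ℕ → ℕ → Bool) → Bool) :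
    InfSat (n + 1) (fun v => !v 0 0 && F v) ↔ false ∈ infFirstBits n F := by
  rw [InfSat]
  refine exists_congr fun x => ?_
  change InfTaut n (fun v => !x 0 && F (consRow x v)) ↔ _
  cases x 0
  · simp
  · simp [not_infTaut_infSat_false]

/-- De Morgan duality with `infSat_not_and_iff`. -/
theorem infTaut_or_not_iff (n : ℕ) (F : (ℕ → ℕ → Bool) → Bool) :
    InfTaut (n + 1) (fun v => v 0 0 || !F v) ↔ false ∉ infFirstBits n F := by
  rw [← infSat_not_and_iff, ← infTaut_not_iff]
  simp

theorem VAL_strongRed_SAT (n : ℕ) : StrongRed (VAL (n + 1)) (SAT (n + 1)).toPromise := by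
  -- The prefix codes `and` followed by `var 0 0`.
  refine ⟨fun w => Word.append ⟨[true, false, false, false, false, false], by simp⟩ w,
    (PolyTime.const _).append .id, fun w b hb => ?_⟩
  obtain rfl : b = _ := hb
  have h := SAT_eq_true_iff (n + 1)
    (Word.append ⟨[true, false, false, false, false, false], by simp⟩ w)
  simp only [Word.append, exprOf_and_cons] at h ⊢
  rw [show (Expr.and (.var 0 0) (exprOf w.1)).eval = fun v => v 0 0 && (exprOf w.1).eval v from rfl,
    infSat_and_iff] at h
  rw [mem_VAL_iff]
  generalize SAT (n + 1) _ = b at h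
  cases b <;> simp_all

theorem VAL_strongRed_coSAT (n : ℕ) : StrongRed (VAL (n + 1)) (coSAT (n + 1)).toPromise := by
  -- The prefix codes `or`, `var 0 0` and `not`.
  refine ⟨fun w => Word.append ⟨[true, true, false, false, false, false, false, true], by simp⟩ w,
    (PolyTime.const _).append .id, fun w b hb => ?_⟩
  obtain rfl : b = _ := hb
  have h := coSAT_eq_true_iff (n + 1)
    (Word.append ⟨[true, true, false, false, false, false, false, true], by simp⟩ w)
  simp only [Word.append, exprOf_or_not_cons] at h ⊢
  rw [show (Expr.or (.var 0 0) (.not (exprOf w.1))).eval =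
    fun v => v 0 0 || !(exprOf w.1).eval v from rfl, infTaut_or_not_iff] at h
  rw [mem_VAL_iff]
  generalize coSAT (n + 1) _ = b at h
  cases b <;> simp_all

theorem exprOf_choice {l₁ l₂ : List Bool} {e₁ e₂ : Expr}
    (h₁ : ∀ k u, l₁.length ≤ k → readExpr k (l₁ ++ u) = (e₁, u))
    (h₂ : ∀ k u, l₂.length ≤ k → readExpr k (l₂ ++ u) = (e₂, u)) :
    exprOf ([true, true, true, false, false, false, false, false] ++ l₁ ++
      ([true, false, false, true, false, false, false, false, false, true] ++ l₂)) =
      .or (.and (.var 0 0) e₁) (.and (.not (.var 0 0)) (.not e₂)) := by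
  have hk : ([true, true, true, false, false, false, false, false] ++ l₁ ++
      ([true, false, false, true, false, false, false, false, false, true] ++ l₂)).length =
      -- Four successors are displayed because the deepest fixed part, `or`, `and`, `not`, `var`,
      -- unfolds `readExpr` four times.
      l₁.length + l₂.length + 14 + 1 + 1 + 1 + 1 := by
    simp only [List.length_append, List.length_cons, List.length_nil]; omega
  have h₂' := h₂ (l₁.length + l₂.length + 14 + 1) [] (by omega)
  rw [List.append_nil] at h₂'
  rw [exprOf, hk]
  simp only [List.cons_append, List.nil_append, readExpr, readNat,
    h₁ (l₁.length + l₂.length + 14 + 1 + 1) _ (by omega), h₂']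

/-- The first bit of `x` decides whether the rest is a witness for `F` or a counterexample
to `G`. -/
theorem mem_infFirstBits_choice (n : ℕ) (F G : (ℕ → ℕ → Bool) → Bool) :
    (true ∈ infFirstBits n (fun v => (v 0 0 && F (oddPart v)) || (!v 0 0 && !G (oddPart v))) ↔
      InfSat (n + 1) F) ∧
    (false ∈ infFirstBits n (fun v => (v 0 0 && F (oddPart v)) || (!v 0 0 && !G (oddPart v))) ↔
      ¬InfTaut (n + 1) G) := by
  -- Bit 0 of a row is not in its odd part, so it can be prescribed freely.
  have key : ∀ (b : Bool) (H : (ℕ → ℕ → Bool) → Bool),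
      (∃ x : ℕ → Bool, x 0 = b ∧ InfTaut n (fun v => H (oddPart (consRow x v)))) ↔
        InfSat (n + 1) H := by
    intro b H
    simp only [InfSat, oddPart_consRow]
    constructor
    · rintro ⟨x, -, hx⟩
      exact ⟨_, (inf_oddPart_iff n fun v => H (consRow _ v)).2.1 hx⟩
    · rintro ⟨x, hx⟩
      refine ⟨spread b x, by simp [spread], ?_⟩
      rw [spread_odd]
      exact (inf_oddPart_iff n fun v => H (consRow _ v)).2.2 hx
  rw [← infSat_not_iff, ← key true, ← key false]
  constructor
  · refine exists_congr fun x => and_congr_right fun hx => ?_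
    simp [consRow, hx]
  · refine exists_congr fun x => and_congr_right fun hx => ?_
    simp [consRow, hx]

theorem strongRed_VAL (n : ℕ) {φ : PromiseProblem} (h₁ : StrongRed φ (SAT (n + 1)).toPromise)
    (h₂ : StrongRed φ (coSAT (n + 1)).toPromise) : StrongRed φ (VAL (n + 1)) := by
  obtain ⟨μ₁, hμ₁, h₁⟩ := h₁
  obtain ⟨μ₂, hμ₂, h₂⟩ := h₂
  obtain ⟨τ, hτ, hr⟩ := exists_isolate
  let p₁ : Word := ⟨[true, true, true, false, false, false, false, false], by simp⟩
  let p₂ : Word := ⟨[true, false, false, true, false, false, false, false, false, true], by simp⟩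
  let ν : Word → Word := fun w =>
    (p₁.append (τ (μ₁ w))).append (p₂.append (τ (μ₂ w)))
  have hν : PolyTime ν := ((PolyTime.const p₁).append (hτ.comp hμ₁)).append
    ((PolyTime.const p₂).append (hτ.comp hμ₂))
  refine ⟨ν, hν, fun w b hb => ?_⟩
  have he : exprOf (ν w).1 = .or (.and (.var 0 0) (exprOf (μ₁ w).1).odd)
      (.and (.not (.var 0 0)) (.not (exprOf (μ₂ w).1).odd)) := by
    have := exprOf_choice (hr (μ₁ w)) (hr (μ₂ w))
    simpa [exprOf, ν, p₁, p₂, Word.append] using this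
  have hF : (exprOf (ν w).1).eval = fun v => (v 0 0 && (exprOf (μ₁ w).1).eval (oddPart v)) ||
      (!v 0 0 && !(exprOf (μ₂ w).1).eval (oddPart v)) := by
    funext v
    simp only [he, Expr.eval, eval_odd]
  obtain ⟨ht, hf⟩ := mem_infFirstBits_choice n (exprOf (μ₁ w).1).eval (exprOf (μ₂ w).1).eval
  rw [← hF, ← SAT_eq_true_iff] at ht
  rw [← hF, ← coSAT_eq_true_iff] at hf
  have h₁ : SAT (n + 1) (μ₁ w) ∈ (φ w).1 := h₁ w rfl
  have h₂ : coSAT (n + 1) (μ₂ w) ∈ (φ w).1 := h₂ w rfl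
  have hb := (mem_VAL_iff n (ν w) b).1 hb
  -- By `ht` and `hf`, `hb` now says that `SAT` or `coSAT` has the value `b` on its instance; `h₁`
  -- or `h₂` then makes `b` valid for `φ`.
  cases b <;> simp only [Bool.not_false, Bool.not_true, ht, hf] at hb <;>
    generalize SAT (n + 1) (μ₁ w) = a at h₁ hb <;>
    generalize coSAT (n + 1) (μ₂ w) = c at h₂ hb <;> cases a <;> cases c <;> simp_all

theorem VHat_eq (n : ℕ) (hn : 1 ≤ n) : VHat n = SigmaHat n ∩ PiHat n := by
  obtain ⟨n, rfl⟩ := Nat.exists_eq_add_of_le' hn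
  ext φ
  exact ⟨fun h => ⟨h.trans (VAL_strongRed_SAT n), h.trans (VAL_strongRed_coSAT n)⟩,
    fun h => strongRed_VAL n h.1 h.2⟩

end PromiseHierarchy

theorem theorem9 (n : ℕ) (hn : 1 ≤ n) :
    PromiseHierarchy.VHat n = PromiseHierarchy.SigmaHat n ∩ PromiseHierarchy.PiHat n ∧
    PromiseHierarchy.IsCompleteFor (PromiseHierarchy.VAL n)
      (PromiseHierarchy.SigmaHat n ∩ PromiseHierarchy.PiHat n) := by
  have h := PromiseHierarchy.VHat_eq n hn
  refine ⟨h, ?_⟩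
  rw [← h]
  exact ⟨.refl _, fun _ hψ => hψ⟩
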